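/- Let $q_1(i),q_2(i)\ge 0$ and $0<p(i)<1$ for $i\ge 1$, with $q_1(i)+q_2(i)+p(i)=1$, and let $p(0)=1$. Consider the $(2,1)$-reflecting random walk, i.e. the Markov chain $(X_n)_{n\ge 0}$ on $\{0,1,2,\dots\}$ with transition probabilities $$P_{01}=p(0)=1,\qquad P_{12}=p(1),\quad P_{10}=q_1(1)+q_2(1),$$ $$P_{i,i+1}=p(i),\quad P_{i,i-1}=q_1(i),\quad P_{i,i-2}=q_2(i)\qquad (i\ge 2),$$ and all other transition probabilities equal to $0$. Write $P^i$ and $E^i$ for probability and expectation when $X_0=i$, and put $T_i=\inf\{n>0: X_n=i\}$ and $N(0)=\sum_{n=1}^{\infty}\mathbf 1_{\{X_n=0\}}$. Let $$M_1=\begin{pmatrix}\frac{q_1(1)+q_2(1)}{p(1)}&0\\ \frac1{p(1)}&0\end{pmatrix},\qquad M_i=\begin{pmatrix}\frac{q_1(i)}{p(i)}&\frac{q_2(i)}{p(i)}\\ 1+\frac{q_1(i)}{p(i)}&\frac{q_2(i)}{p(i)}\end{pmatrix}\quad(i>1),$$ $e_1=(1,0)$, $u=(1,1)^{\mathsf T}$,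 and $$\kappa=\sum_{k=1}^{\infty}e_1M_kM_{k-1}\cdots M_1u\in[0,\infty].$$ If $\kappa=\infty$, then the walk is recurrent, i.e. $P^i(T_i<\infty)=1$ for every state $i$. Moreover, $\kappa=E^0N(0)$ (as an identity in $[0,\infty]$). -/

import Mathlib

open MeasureTheory ProbabilityTheory
open scoped ENNReal

noncomputable section

/-- The parameters of a `(2,1)`-reflecting random walk on `{0, 1, 2, …}`: from a site `i ≥ 1` the
walk jumps one step up with probability `p i`, one step down with probability `q₁ i` and two steps
down with probability `q₂ i`. The values of `q₁` and `q₂` at the site `0` play no role. -/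
structure ReflectingWalk where
  p : ℕ → ℝ
  q₁ : ℕ → ℝ
  q₂ : ℕ → ℝ
  p_zero : p 0 = 1
  p_pos : ∀ i, 1 ≤ i → 0 < p i
  p_lt_one : ∀ i, 1 ≤ i → p i < 1
  q₁_nonneg : ∀ i, 1 ≤ i → 0 ≤ q₁ i
  q₂_nonneg : ∀ i, 1 ≤ i → 0 ≤ q₂ i
  sum_eq_one : ∀ i, 1 ≤ i → q₁ i + q₂ i + p i = 1

namespace ReflectingWalk

/-- The transition matrix `P i j`; at the site `1` both kinds of downward jumps lead to `0`. -/
def transition (W : ReflectingWalk) (i j : ℕ) : ℝ :=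
  if i = 0 then
    if j = 1 then W.p 0 else 0
  else if i = 1 then
    if j = 2 then W.p 1 else if j = 0 then W.q₁ 1 + W.q₂ 1 else 0
  else
    if j = i + 1 then W.p i else if j + 1 = i then W.q₁ i else if j + 2 = i then W.q₂ i else 0

lemma hasSum_transition (W : ReflectingWalk) (i : ℕ) :
    HasSum (fun j => ENNReal.ofReal (W.transition i j)) 1 := by
  rcases Nat.lt_or_ge i 1 with h0 | h0
  · obtain rfl : i = 0 := by omega
    have h : ∀ j ∉ ({1} : Finset ℕ), ENNReal.ofReal (W.transition 0 j) = 0 := by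
      intro j hj
      simp_all [transition]
    convert hasSum_sum_of_ne_finset_zero (L := .unconditional ℕ) h using 1
    simp [transition, W.p_zero]
  · have hp := (W.p_pos i h0).le
    have h1 := W.q₁_nonneg i h0
    have h2 := W.q₂_nonneg i h0
    have hs := W.sum_eq_one i h0
    rcases Nat.lt_or_ge i 2 with h3 | h3
    · obtain rfl : i = 1 := by omega
      have h : ∀ j ∉ ({0, 2} : Finset ℕ), ENNReal.ofReal (W.transition 1 j) = 0 := by
        intro j hj
        simp_all [transition]
      convert hasSum_sum_of_ne_finset_zero (L := .unconditional ℕ) h using 1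
      simp only [transition]
      rw [Finset.sum_pair (by norm_num)]
      simp only [one_ne_zero, OfNat.zero_ne_ofNat, if_false, if_true]
      rw [← ENNReal.ofReal_add (add_nonneg h1 h2) hp, hs, ENNReal.ofReal_one]
    · obtain ⟨k, rfl⟩ : ∃ k, i = k + 2 := ⟨i - 2, by omega⟩
      have h : ∀ j ∉ ({k + 3, k + 1, k} : Finset ℕ),
          ENNReal.ofReal (W.transition (k + 2) j) = 0 := by
        intro j hj
        simp_all [transition]
      convert hasSum_sum_of_ne_finset_zero (L := .unconditional ℕ) h using 1
      rw [Finset.sum_insert (by simp), Finset.sum_pair (by simp)]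
      simp only [transition]
      simp [show k ≠ k + 2 + 1 by omega]
      rw [← ENNReal.ofReal_add h1 h2, ← ENNReal.ofReal_add hp (add_nonneg h1 h2),
        show W.p (k + 2) + (W.q₁ (k + 2) + W.q₂ (k + 2)) = 1 by linarith, ENNReal.ofReal_one]

/-- The law of one step from the site `i`: it gives mass `P i j` to `j`. -/
def stepPMF (W : ReflectingWalk) (i : ℕ) : PMF ℕ :=
  ⟨fun j => ENNReal.ofReal (W.transition i j), W.hasSum_transition i⟩

/-- The transition kernel on the state space. -/
def stepKernel (W : ReflectingWalk) : Kernel ℕ ℕ :=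
  Kernel.ofFunOfCountable fun i => (W.stepPMF i).toMeasure

instance (W : ReflectingWalk) : IsMarkovKernel W.stepKernel :=
  ⟨fun i => inferInstanceAs (IsProbabilityMeasure (W.stepPMF i).toMeasure)⟩

/-- The conditional law of `X (n + 1)` given the history `(X 0, …, X n)`; it depends on the
history only through `X n`. -/
def historyKernel (W : ReflectingWalk) (n : ℕ) : Kernel (Finset.Iic n → ℕ) ℕ :=
  W.stepKernel.comap (fun h => h ⟨n, Finset.mem_Iic.2 le_rfl⟩) (measurable_pi_apply _)

instance (W : ReflectingWalk) (n : ℕ) : IsMarkovKernel (W.historyKernel n) :=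
  inferInstanceAs (IsMarkovKernel (W.stepKernel.comap _ _))

/-- `P^i`, the law on the path space `ℕ → ℕ` of the Markov chain with transition matrix
`W.transition` started at `X 0 = i`; the chain is the coordinate process `X n ω = ω n`. -/
def pathLaw (W : ReflectingWalk) (i : ℕ) : Measure (ℕ → ℕ) :=
  Kernel.traj (X := fun _ => ℕ) W.historyKernel 0 (fun _ => i)

/-- `N(i)`, the number of times `n ≥ 1` at which the path visits `i`. -/
def visits (i : ℕ) (ω : ℕ → ℕ) : ℝ≥0∞ :=
  ∑' n : ℕ, if ω (n + 1) = i then 1 else 0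

/-- `T_i = inf {n > 0 : X n = i}`, with value `⊤` if there is no such `n`. -/
def hittingTime (i : ℕ) (ω : ℕ → ℕ) : ℕ∞ :=
  ⨅ (n : ℕ) (_ : 0 < n ∧ ω n = i), (n : ℕ∞)

/-- The walk is recurrent: started at any state it returns to this state almost surely. -/
def IsRecurrent (W : ReflectingWalk) : Prop :=
  ∀ i, W.pathLaw i {ω | hittingTime i ω < ⊤} = 1

/-- The offspring mean matrices `M i`, `i ≥ 1` (the value at `i = 0` is not used). -/
def meanMatrix (W : ReflectingWalk) (i : ℕ) : Matrix (Fin 2) (Fin 2) ℝ :=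
  if i = 1 then
    !![(W.q₁ 1 + W.q₂ 1) / W.p 1, 0;
       1 / W.p 1, 0]
  else
    !![W.q₁ i / W.p i, W.q₂ i / W.p i;
       1 + W.q₁ i / W.p i, W.q₂ i / W.p i]

/-- The product `M k * M (k - 1) * ⋯ * M 1`. -/
def meanProd (W : ReflectingWalk) : ℕ → Matrix (Fin 2) (Fin 2) ℝ
  | 0 => 1
  | k + 1 => W.meanMatrix (k + 1) * W.meanProd k

/-- `κ = ∑_{k ≥ 1} e₁ M_k M_{k-1} ⋯ M_1 u` with `e₁ = (1, 0)` and `u = (1, 1)ᵀ`, a series of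
nonnegative terms with sum in `[0, ∞]`. -/
def kappa (W : ReflectingWalk) : ℝ≥0∞ :=
  ∑' k : ℕ, ENNReal.ofReal (![1, 0] ⬝ᵥ (W.meanProd (k + 1)).mulVec ![1, 1])

end ReflectingWalk

end

/-! Write `P` for the transition operator and `d k = e₁ M_k ⋯ M_1 u` with `d 0 = 1`. The matrix
recursion says exactly that `S x = ∑_{k<x} d k` is harmonic off `0`, with `P S = S + 1_0`
(`transitionOp_scale`).

Identity: let `G` be the expected number of visits to `0` from `0`, time `0` included. If `S ∞ = 1 +
κ` is finite, `S ∞ - S` is nonnegative with charge `1_0`, so it dominates the potential of `1_0`,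
and `G ≤ 1 + κ`. If `G` is finite, the walk leaves finite sets; comparing the potential with the
finitely supported function `(S n - S)⁺` gives `S n ≤ G` for all `n`. Hence `1 + κ = G = 1 + E⁰
N(0)`.

Recurrence: let `a x` be the probability of avoiding `i` at all positive times from `x`. Setting `a`
to zero at `i` gives a bounded subharmonic `v` with `P v = a`. Subharmonic functions are
nondecreasing, and once they increase their increments dominate a multiple of `d`. If `κ = ∞`,
boundedness forces `v = 0` up to `i + 1`, so `a i = P v i = 0`. -/

noncomputable section

open Filter Topology

namespace ReflectingWalk

/-! ### The transition operator. -/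

/-- The transition operator `f ↦ (x ↦ ∑ y, P x y * f y)` on real functions. Truncated subtraction
merges the two downward jumps from the site `1`. -/
def transitionOp (W : ReflectingWalk) : (ℕ → ℝ) →ₗ[ℝ] (ℕ → ℝ) where
  toFun f x := if x = 0 then f 1 else
    W.p x * f (x + 1) + W.q₁ x * f (x - 1) + W.q₂ x * f (x - 2)
  map_add' f g := by ext x; by_cases h : x = 0 <;> simp [h]; ring
  map_smul' c f := by ext x; by_cases h : x = 0 <;> simp [h]; ring

lemma transitionOp_zero (W : ReflectingWalk) (f : ℕ → ℝ) : W.transitionOp f 0 = f 1 := by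
  simp [transitionOp]

lemma transitionOp_of_pos (W : ReflectingWalk) (f : ℕ → ℝ) {x : ℕ} (hx : 1 ≤ x) :
    W.transitionOp f x = W.p x * f (x + 1) + W.q₁ x * f (x - 1) + W.q₂ x * f (x - 2) := by
  simp [transitionOp, show x ≠ 0 by omega]

lemma transitionOp_mono (W : ReflectingWalk) : Monotone W.transitionOp := by
  intro f g hfg x
  rcases Nat.eq_zero_or_pos x with rfl | hx
  · simpa [transitionOp_zero] using hfg 1
  · rw [W.transitionOp_of_pos _ hx, W.transitionOp_of_pos _ hx]
    exact add_le_add (add_le_add (mul_le_mul_of_nonneg_left (hfg _) (W.p_pos x hx).le)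
      (mul_le_mul_of_nonneg_left (hfg _) (W.q₁_nonneg x hx)))
      (mul_le_mul_of_nonneg_left (hfg _) (W.q₂_nonneg x hx))

lemma transitionOp_nonneg (W : ReflectingWalk) {f : ℕ → ℝ} (hf : 0 ≤ f) :
    0 ≤ W.transitionOp f := by
  simpa using W.transitionOp_mono hf

lemma transitionOp_const (W : ReflectingWalk) (c : ℝ) :
    W.transitionOp (fun _ => c) = fun _ => c := by
  ext x
  rcases Nat.eq_zero_or_pos x with rfl | hx
  · simp [transitionOp_zero]
  · rw [W.transitionOp_of_pos _ hx, ← add_mul, ← add_mul,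
      show W.p x + W.q₁ x + W.q₂ x = 1 by linarith [W.sum_eq_one x hx], one_mul]

lemma transitionOp_pow_mono (W : ReflectingWalk) (n : ℕ) : Monotone ⇑(W.transitionOp ^ n) := by
  rw [Module.End.coe_pow]
  exact W.transitionOp_mono.iterate n

lemma transitionOp_pow_nonneg (W : ReflectingWalk) (n : ℕ) {f : ℕ → ℝ} (hf : 0 ≤ f) :
    0 ≤ (W.transitionOp ^ n) f := by
  simpa using W.transitionOp_pow_mono n hf

lemma tendsto_transitionOp (W : ReflectingWalk) {f : ℕ → ℕ → ℝ} {g : ℕ → ℝ}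
    (h : ∀ x, Tendsto (fun n => f n x) atTop (𝓝 (g x))) (x : ℕ) :
    Tendsto (fun n => W.transitionOp (f n) x) atTop (𝓝 (W.transitionOp g x)) := by
  rcases Nat.eq_zero_or_pos x with rfl | hx
  · simpa [transitionOp_zero] using h 1
  · simp only [W.transitionOp_of_pos _ hx]
    exact (((h _).const_mul _).add ((h _).const_mul _)).add ((h _).const_mul _)

lemma lintegral_stepKernel (W : ReflectingWalk) {f : ℕ → ℝ} (hf : 0 ≤ f) (x : ℕ) :
    ∫⁻ y, ENNReal.ofReal (f y) ∂W.stepKernel x = ENNReal.ofReal (W.transitionOp f x) := by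
  have hsum : ∫⁻ y, ENNReal.ofReal (f y) ∂W.stepKernel x
      = ∑' y, ENNReal.ofReal (W.transition x y) * ENNReal.ofReal (f y) := by
    rw [lintegral_countable']
    refine tsum_congr fun y => ?_
    rw [mul_comm]
    congr 1
    exact PMF.toMeasure_apply_singleton _ _ (measurableSet_singleton y)
  rw [hsum]
  rcases Nat.eq_zero_or_pos x with rfl | hx
  · rw [tsum_eq_single 1 (by intro y hy; simp [transition, hy])]
    simp [transition, W.p_zero, transitionOp_zero]
  have hp := (W.p_pos x hx).le
  have h1 := W.q₁_nonneg x hx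
  have h2 := W.q₂_nonneg x hx
  rw [W.transitionOp_of_pos _ hx]
  obtain rfl | ⟨k, rfl⟩ : x = 1 ∨ ∃ k, x = k + 2 := by
    rcases Nat.lt_or_ge x 2 with h | h
    · left; omega
    · exact Or.inr ⟨x - 2, by omega⟩
  · rw [tsum_eq_sum (s := {0, 2}) (by intro y hy; simp_all [transition]),
      Finset.sum_pair (by norm_num)]
    simp only [transition, one_ne_zero, OfNat.zero_ne_ofNat, if_false, if_true]
    rw [← ENNReal.ofReal_mul (add_nonneg h1 h2), ← ENNReal.ofReal_mul hp,
      ← ENNReal.ofReal_add (mul_nonneg (add_nonneg h1 h2) (hf _)) (mul_nonneg hp (hf _))]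
    congr 1
    norm_num
    ring
  · rw [tsum_eq_sum (s := {k + 3, k + 1, k}) (by intro y hy; simp_all [transition]),
      Finset.sum_insert (by simp), Finset.sum_pair (by simp)]
    simp only [transition]
    simp [show k ≠ k + 2 + 1 by omega]
    rw [← ENNReal.ofReal_mul h1, ← ENNReal.ofReal_mul h2, ← ENNReal.ofReal_mul hp,
      ← ENNReal.ofReal_add (mul_nonneg h1 (hf _)) (mul_nonneg h2 (hf _)),
      ← ENNReal.ofReal_add (mul_nonneg hp (hf _))
        (add_nonneg (mul_nonneg h1 (hf _)) (mul_nonneg h2 (hf _))), add_assoc]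

/-! ### Path integrals as iterates of the operator. -/

instance (W : ReflectingWalk) (i : ℕ) : IsProbabilityMeasure (W.pathLaw i) :=
  inferInstanceAs (IsProbabilityMeasure (Kernel.traj (X := fun _ => ℕ) W.historyKernel 0 _))

/-- The Markov property at time `n`. -/
lemma lintegral_pathLaw_succ (W : ReflectingWalk) (i n : ℕ) (F : (Finset.Iic n → ℕ) → ℝ≥0∞)
    (g : ℕ → ℝ≥0∞) :
    ∫⁻ ω, F (Preorder.frestrictLe (π := fun _ => ℕ) n ω) * g (ω (n + 1)) ∂W.pathLaw i =
      ∫⁻ ω, F (Preorder.frestrictLe (π := fun _ => ℕ) n ω) *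
        ∫⁻ y, g y ∂W.stepKernel (ω n) ∂W.pathLaw i := by
  have key := Kernel.partialTraj_compProd_eq_map_traj (X := fun _ => ℕ) (κ := W.historyKernel)
    (Nat.zero_le n) (x₀ := fun _ => i)
  have hF : Measurable F := measurable_of_countable F
  have hg : Measurable g := measurable_of_countable g
  have hm : Measurable fun z : (Finset.Iic n → ℕ) × ℕ => F z.1 * g z.2 := by fun_prop
  have h1 : ∫⁻ ω, F (Preorder.frestrictLe (π := fun _ => ℕ) n ω) * g (ω (n + 1)) ∂W.pathLaw i =
      ∫⁻ z, F z.1 * g z.2 ∂((W.pathLaw i).map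
        fun ω => (Preorder.frestrictLe (π := fun _ => ℕ) n ω, ω (n + 1))) := by
    rw [lintegral_map hm (by fun_prop)]
  rw [h1, pathLaw, ← key, Measure.lintegral_compProd hm, ← Kernel.traj_map_frestrictLe_apply,
    lintegral_map (measurable_of_countable _) (by fun_prop)]
  refine lintegral_congr fun ω => ?_
  dsimp only
  rw [lintegral_const_mul _ hg, historyKernel, Kernel.comap_apply]
  rfl

lemma lintegral_pathLaw_zero (W : ReflectingWalk) (i : ℕ) (g : ℕ → ℝ≥0∞) :
    ∫⁻ ω, g (ω 0) ∂W.pathLaw i = g i := by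
  have h := Kernel.traj_map_frestrictLe_apply (X := fun _ => ℕ) (κ := W.historyKernel)
    0 0 (fun _ => i)
  have hm : Measurable fun z : Finset.Iic 0 → ℕ => g (z ⟨0, by simp⟩) := measurable_of_countable _
  have h1 : ∫⁻ ω, g (ω 0) ∂W.pathLaw i = ∫⁻ z, g (z ⟨0, by simp⟩)
      ∂((W.pathLaw i).map (Preorder.frestrictLe (π := fun _ => ℕ) 0)) := by
    rw [lintegral_map hm (by fun_prop)]
    rfl
  rw [h1, pathLaw, h, Kernel.partialTraj_self, Kernel.id_apply, lintegral_dirac' _ hm]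

/-- A discrete Feynman–Kac formula: the weights `φ (X 1), …, φ (X n)` along the path. -/
lemma lintegral_pathLaw_prod (W : ReflectingWalk) {φ : ℕ → ℝ} (hφ : 0 ≤ φ) (i n : ℕ)
    {f : ℕ → ℝ} (hf : 0 ≤ f) :
    ∫⁻ ω, (∏ m ∈ Finset.range n, ENNReal.ofReal (φ (ω (m + 1)))) * ENNReal.ofReal (f (ω n))
      ∂W.pathLaw i = ENNReal.ofReal ((fun g => W.transitionOp (φ * g))^[n] f i) := by
  induction n generalizing f with
  | zero => simpa using W.lintegral_pathLaw_zero i fun x => ENNReal.ofReal (f x)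
  | succ n ih =>
    have hφf : 0 ≤ φ * f := mul_nonneg hφ hf
    -- The innermost factor of the iterate is the last step of the path, so `f` changes in the
    -- induction.
    rw [Function.iterate_succ_apply, ← ih (W.transitionOp_nonneg hφf)]
    have := W.lintegral_pathLaw_succ i n
      (fun z => ∏ m : Fin n, ENNReal.ofReal (φ (z ⟨m + 1, by simp⟩)))
      (fun y => ENNReal.ofReal ((φ * f) y))
    simp only [W.lintegral_stepKernel hφf, Preorder.frestrictLe_apply] at this
    have hprod (ω : ℕ → ℕ) : ∏ m : Fin n, ENNReal.ofReal (φ (ω (m + 1))) =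
        ∏ m ∈ Finset.range n, ENNReal.ofReal (φ (ω (m + 1))) :=
      Fin.prod_univ_eq_prod_range (fun m => ENNReal.ofReal (φ (ω (m + 1)))) n
    simp only [hprod] at this
    rw [← this]
    refine lintegral_congr fun ω => ?_
    rw [Finset.prod_range_succ, mul_assoc, Pi.mul_apply, ENNReal.ofReal_mul (hφ _)]

/-! ### The scale function. -/

/-- The increments `e₁ M_k ⋯ M_1 u` of the scale function. -/
def scaleIncr (W : ReflectingWalk) (k : ℕ) : ℝ := (W.meanProd k).mulVec ![1, 1] 0

lemma scaleIncr_zero (W : ReflectingWalk) : W.scaleIncr 0 = 1 := by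
  simp [scaleIncr, meanProd]

/-- In every `M_i` the second row is the first plus `(1, 0)`; for `i = 1` this is `q₁ + q₂ + p = 1`.
The vector recursion thus becomes a scalar one of order two. -/
lemma meanProd_succ_mulVec_one (W : ReflectingWalk) (k : ℕ) :
    (W.meanProd (k + 1)).mulVec ![1, 1] 1 = W.scaleIncr (k + 1) + W.scaleIncr k := by
  simp only [scaleIncr, meanProd, ← Matrix.mulVec_mulVec]
  rcases k with _ | k
  · have hp := (W.p_pos 1 le_rfl).ne'
    simp [meanProd, meanMatrix, Matrix.mulVec, dotProduct, Fin.sum_univ_two]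
    field_simp
    linarith [W.sum_eq_one 1 le_rfl]
  · simp [meanMatrix, Matrix.mulVec, dotProduct, Fin.sum_univ_two]
    ring

lemma p_mul_scaleIncr_one (W : ReflectingWalk) :
    W.p 1 * W.scaleIncr 1 = W.q₁ 1 + W.q₂ 1 := by
  have hp := (W.p_pos 1 le_rfl).ne'
  simp [scaleIncr, meanProd, meanMatrix, Matrix.mulVec, dotProduct, Fin.sum_univ_two]
  field_simp

lemma p_mul_scaleIncr (W : ReflectingWalk) (k : ℕ) :
    W.p (k + 2) * W.scaleIncr (k + 2) = W.q₁ (k + 2) * W.scaleIncr (k + 1) +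
      W.q₂ (k + 2) * (W.scaleIncr (k + 1) + W.scaleIncr k) := by
  have hp := (W.p_pos (k + 2) (by omega)).ne'
  rw [← meanProd_succ_mulVec_one, scaleIncr, meanProd, ← Matrix.mulVec_mulVec]
  generalize hv : (W.meanProd (k + 1)).mulVec ![1, 1] = v
  have h0 : W.scaleIncr (k + 1) = v 0 := by rw [← hv, scaleIncr]
  rw [h0]
  simp [meanMatrix, Matrix.mulVec, dotProduct, Fin.sum_univ_two]
  field_simp

lemma q_add_pos (W : ReflectingWalk) {x : ℕ} (hx : 1 ≤ x) : 0 < W.q₁ x + W.q₂ x := by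
  linarith [W.sum_eq_one x hx, W.p_lt_one x hx]

lemma scaleIncr_pos (W : ReflectingWalk) (k : ℕ) : 0 < W.scaleIncr k := by
  induction k using Nat.twoStepInduction with
  | zero => simp [scaleIncr_zero]
  | one =>
    refine pos_of_mul_pos_right ?_ (W.p_pos 1 le_rfl).le
    rw [p_mul_scaleIncr_one]
    exact W.q_add_pos le_rfl
  | more k h0 h1 =>
    refine pos_of_mul_pos_right ?_ (W.p_pos (k + 2) (by omega)).le
    rw [p_mul_scaleIncr]
    have := mul_pos (W.q_add_pos (x := k + 2) (by omega)) h1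
    have := mul_nonneg (W.q₂_nonneg (k + 2) (by omega)) h0.le
    linarith

/-- The scale function: it vanishes at `0` and is harmonic at all other sites. -/
def scale (W : ReflectingWalk) (x : ℕ) : ℝ := ∑ k ∈ Finset.range x, W.scaleIncr k

lemma scale_succ (W : ReflectingWalk) (x : ℕ) : W.scale (x + 1) = W.scale x + W.scaleIncr x :=
  Finset.sum_range_succ _ _

lemma scale_mono (W : ReflectingWalk) : Monotone W.scale :=
  monotone_nat_of_le_succ fun x => by linarith [W.scale_succ x, W.scaleIncr_pos x]

/-- The scale function is harmonic off `0`. -/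
lemma transitionOp_scale (W : ReflectingWalk) :
    W.transitionOp W.scale = W.scale + Pi.single 0 1 := by
  ext x
  have h0 : W.scale 0 = 0 := by simp [scale]
  have h1 : W.scale 1 = 1 := by rw [scale_succ, h0, scaleIncr_zero, zero_add]
  rcases x with _ | _ | k
  · simp [transitionOp_zero, h0, h1]
  · rw [W.transitionOp_of_pos _ (by omega)]
    simp only [zero_add, scale_succ _ 1, h0, h1, Pi.add_apply,
      show 1 - 2 = 0 from rfl, Nat.reduceAdd]
    have := W.p_mul_scaleIncr_one
    simp
    linarith [W.sum_eq_one 1 le_rfl]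
  · rw [W.transitionOp_of_pos _ (by omega)]
    simp only [show k + 1 + 1 = k + 2 from rfl, show k + 2 - 1 = k + 1 from rfl,
      Nat.add_sub_cancel, Pi.add_apply]
    have h := W.p_mul_scaleIncr k
    rw [scale_succ _ (k + 2), scale_succ _ (k + 1), scale_succ _ k]
    have hs : W.p (k + 2) = 1 - W.q₁ (k + 2) - W.q₂ (k + 2) := by
      linarith [W.sum_eq_one (k + 2) (by omega)]
    rw [Pi.single_eq_of_ne (by omega)]
    linear_combination h + (W.scale k + W.scaleIncr k + W.scaleIncr (k + 1)) * hs

lemma kappa_eq_tsum (W : ReflectingWalk) :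
    W.kappa = ∑' k, ENNReal.ofReal (W.scaleIncr (k + 1)) := by
  simp [kappa, scaleIncr, dotProduct, Fin.sum_univ_two]

lemma one_add_kappa (W : ReflectingWalk) :
    1 + W.kappa = ∑' k, ENNReal.ofReal (W.scaleIncr k) := by
  rw [tsum_eq_zero_add' ENNReal.summable, scaleIncr_zero, kappa_eq_tsum, ENNReal.ofReal_one]

/-! ### Expected returns to `0`. -/

lemma sum_transitionOp_pow_le (W : ReflectingWalk) {f w : ℕ → ℝ} (hw : 0 ≤ w)
    (h : f + W.transitionOp w ≤ w) (n : ℕ) :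
    ∑ m ∈ Finset.range n, (W.transitionOp ^ m) f ≤ w := by
  induction n with
  | zero => simpa using hw
  | succ n ih =>
    rw [Finset.sum_range_succ', add_comm]
    simp only [pow_succ', Module.End.mul_apply, ← map_sum, pow_zero, Module.End.one_apply]
    exact (add_le_add_right (W.transitionOp_mono ih) f).trans h

/-- Unlike the upper bound, this one keeps a remainder, which must be shown to vanish. -/
lemma le_sum_transitionOp_pow (W : ReflectingWalk) {f w : ℕ → ℝ}
    (h : w ≤ f + W.transitionOp w) (n : ℕ) :
    w ≤ ∑ m ∈ Finset.range n, (W.transitionOp ^ m) f + (W.transitionOp ^ n) w := by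
  induction n with
  | zero => simp
  | succ n ih =>
    have := W.transitionOp_pow_mono n h
    rw [map_add] at this
    rw [Finset.sum_range_succ, add_assoc, pow_succ, Module.End.mul_apply]
    exact ih.trans (add_le_add_right this _)

/-- The probability of being at `0` at time `n` for the walk started at `0`. -/
def returnProb (W : ReflectingWalk) (n : ℕ) : ℝ := (W.transitionOp ^ n) (Pi.single 0 1) 0

lemma single_nonneg (x : ℕ) : (0 : ℕ → ℝ) ≤ Pi.single x 1 := by simp

lemma returnProb_nonneg (W : ReflectingWalk) (n : ℕ) : 0 ≤ W.returnProb n :=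
  W.transitionOp_pow_nonneg n (single_nonneg 0) 0

/-- The site `0` can be reached from every site. -/
lemma exists_transitionOp_pow_pos (W : ReflectingWalk) (x : ℕ) :
    ∃ n, 0 < (W.transitionOp ^ n) (Pi.single 0 1) x := by
  induction x using Nat.strong_induction_on with
  | _ x ih =>
    rcases Nat.eq_zero_or_pos x with rfl | hx
    · exact ⟨0, by simp⟩
    have hstep (y : ℕ) (hy : y < x) (q : ℝ) (hq : 0 < q)
        (h : ∀ f : ℕ → ℝ, 0 ≤ f → q * f y ≤ W.transitionOp f x) :
        ∃ n, 0 < (W.transitionOp ^ n) (Pi.single 0 1) x := by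
      obtain ⟨n, hn⟩ := ih y hy
      refine ⟨n + 1, ?_⟩
      rw [pow_succ', Module.End.mul_apply]
      exact (mul_pos hq hn).trans_le (h _ (W.transitionOp_pow_nonneg n (single_nonneg 0)))
    have hp := (W.p_pos x hx).le
    have h1 := W.q₁_nonneg x hx
    have h2 := W.q₂_nonneg x hx
    rcases h1.eq_or_lt with h | h
    · refine hstep (x - 2) (by omega) (W.q₂ x) (by linarith [W.q_add_pos hx]) fun f hf => ?_
      rw [W.transitionOp_of_pos _ hx]
      linarith [mul_nonneg hp (hf (x + 1)), mul_nonneg h1 (hf (x - 1))]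
    · refine hstep (x - 1) (by omega) (W.q₁ x) h fun f hf => ?_
      rw [W.transitionOp_of_pos _ hx]
      linarith [mul_nonneg hp (hf (x + 1)), mul_nonneg h2 (hf (x - 2))]

/-- If the expected number of returns to `0` is finite, the walk leaves every site for good. -/
lemma tendsto_transitionOp_pow_single (W : ReflectingWalk) (hs : Summable W.returnProb) (x : ℕ) :
    Tendsto (fun n => (W.transitionOp ^ n) (Pi.single x 1) 0) atTop (𝓝 0) := by
  obtain ⟨k, hk⟩ := W.exists_transitionOp_pow_pos x
  set c := (W.transitionOp ^ k) (Pi.single 0 1) x with hc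
  -- Going from `x` to `0` in `k` steps costs a factor `c`, so visits to `x` are controlled by
  -- visits to `0`.
  have hle : c • (Pi.single x 1 : ℕ → ℝ) ≤ (W.transitionOp ^ k) (Pi.single 0 1) := by
    intro y
    rcases eq_or_ne y x with rfl | hy
    · simp [hc]
    · simpa [hy] using W.transitionOp_pow_nonneg k (single_nonneg 0) y
  have hbound (n : ℕ) :
      (W.transitionOp ^ n) (Pi.single x 1) 0 ≤ c⁻¹ * W.returnProb (n + k) := by
    have := W.transitionOp_pow_mono n hle 0
    rw [map_smul, ← Module.End.mul_apply, ← pow_add] at this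
    rw [le_inv_mul_iff₀ hk]
    exact this
  refine squeeze_zero (fun n => W.transitionOp_pow_nonneg n (single_nonneg x) 0) hbound ?_
  simpa using ((tendsto_add_atTop_iff_nat k).2 hs.tendsto_atTop_zero).const_mul c⁻¹

lemma summable_of_tsum_ofReal_ne_top {f : ℕ → ℝ} (hf : ∀ n, 0 ≤ f n)
    (h : ∑' n, ENNReal.ofReal (f n) ≠ ⊤) : Summable f := by
  simpa [ENNReal.toReal_ofReal (hf _)] using ENNReal.summable_toReal h

lemma tsum_returnProb_le (W : ReflectingWalk) :
    ∑' n, ENNReal.ofReal (W.returnProb n) ≤ ∑' k, ENNReal.ofReal (W.scaleIncr k) := by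
  by_cases htop : ∑' k, ENNReal.ofReal (W.scaleIncr k) = ⊤
  · simp [htop]
  have hd (k : ℕ) : 0 ≤ W.scaleIncr k := (W.scaleIncr_pos k).le
  have hs := summable_of_tsum_ofReal_ne_top hd htop
  rw [← ENNReal.ofReal_tsum_of_nonneg hd hs]
  refine ENNReal.tsum_le_of_sum_range_le fun n => ?_
  rw [← ENNReal.ofReal_sum_of_nonneg fun m _ => W.returnProb_nonneg m]
  refine ENNReal.ofReal_le_ofReal ?_
  set S := ∑' k, W.scaleIncr k
  have hw : 0 ≤ (fun _ => S) - W.scale := fun x => by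
    simpa using! hs.sum_le_tsum (Finset.range x) fun k _ => hd k
  have hle := W.sum_transitionOp_pow_le (f := Pi.single 0 1) hw
    (by rw [map_sub, transitionOp_const, transitionOp_scale]
        intro x
        simp only [Pi.add_apply, Pi.sub_apply]
        linarith) n 0
  simpa [returnProb, Finset.sum_apply, scale] using hle

lemma le_tsum_returnProb (W : ReflectingWalk) :
    ∑' k, ENNReal.ofReal (W.scaleIncr k) ≤ ∑' n, ENNReal.ofReal (W.returnProb n) := by
  by_cases htop : ∑' n, ENNReal.ofReal (W.returnProb n) = ⊤
  · simp [htop]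
  have hs := summable_of_tsum_ofReal_ne_top W.returnProb_nonneg htop
  rw [← ENNReal.ofReal_tsum_of_nonneg W.returnProb_nonneg hs]
  refine ENNReal.tsum_le_of_sum_range_le fun n => ?_
  rw [← ENNReal.ofReal_sum_of_nonneg fun k _ => (W.scaleIncr_pos k).le]
  refine ENNReal.ofReal_le_ofReal ?_
  change W.scale n ≤ _
  -- Truncating at `S n` makes `w` finitely supported; a maximum of subsolutions is still a
  -- subsolution.
  set w : ℕ → ℝ := fun x => max (W.scale n - W.scale x) 0 with hw
  have hw0 : 0 ≤ w := fun x => le_max_right _ _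
  have hsub : w ≤ Pi.single 0 1 + W.transitionOp w := by
    intro x
    refine max_le ?_ (add_nonneg (single_nonneg 0 x) (W.transitionOp_nonneg hw0 x))
    have h := W.transitionOp_mono (show (fun _ => W.scale n) - W.scale ≤ w from
      fun y => le_max_left _ _) x
    rw [map_sub, transitionOp_const, transitionOp_scale] at h
    simp only [Pi.sub_apply, Pi.add_apply] at h ⊢
    linarith
  have hdecomp : w = ∑ x ∈ Finset.range n, w x • (Pi.single x 1 : ℕ → ℝ) := by
    ext y
    simp only [Finset.sum_apply, Pi.smul_apply, Pi.single_apply, smul_eq_mul, mul_ite, mul_one,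
      mul_zero, Finset.sum_ite_eq, Finset.mem_range]
    split_ifs with hy
    · rfl
    · exact max_eq_right (by linarith [W.scale_mono (not_lt.1 hy)])
  have hlim : Tendsto (fun m => (W.transitionOp ^ m) w 0) atTop (𝓝 0) := by
    rw [hdecomp]
    simp only [map_sum, map_smul, Finset.sum_apply, Pi.smul_apply, smul_eq_mul]
    simpa using tendsto_finsetSum (Finset.range n)
      fun x _ => (W.tendsto_transitionOp_pow_single hs x).const_mul (w x)
  have hle (m : ℕ) : W.scale n ≤
      ∑ k ∈ Finset.range m, W.returnProb k + (W.transitionOp ^ m) w 0 := by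
    have h := W.le_sum_transitionOp_pow hsub m 0
    simp only [Pi.add_apply, Finset.sum_apply] at h
    refine le_trans ?_ h
    simp [hw, scale]
  have := ge_of_tendsto (hs.hasSum.tendsto_sum_nat.add hlim) (Eventually.of_forall hle)
  simpa using this

lemma lintegral_visits (W : ReflectingWalk) :
    ∫⁻ ω, visits 0 ω ∂W.pathLaw 0 = ∑' n, ENNReal.ofReal (W.returnProb (n + 1)) := by
  have hm (n : ℕ) : Measurable fun ω : ℕ → ℕ => if ω (n + 1) = 0 then (1 : ℝ≥0∞) else 0 :=
    (measurable_of_countable fun x : ℕ => if x = 0 then (1 : ℝ≥0∞) else 0).comp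
      (measurable_pi_apply (n + 1))
  simp only [visits]
  rw [lintegral_tsum fun n => (hm n).aemeasurable]
  refine tsum_congr fun n => ?_
  have h := W.lintegral_pathLaw_prod (φ := 1) zero_le_one 0 (n + 1) (single_nonneg 0)
  simp only [one_mul, Pi.one_apply, ENNReal.ofReal_one, Finset.prod_const_one] at h
  rw [returnProb, Module.End.coe_pow, ← h]
  refine lintegral_congr fun ω => ?_
  by_cases hω : ω (n + 1) = 0 <;> simp [hω]

lemma kappa_eq_lintegral_visits (W : ReflectingWalk) :
    W.kappa = ∫⁻ ω, visits 0 ω ∂W.pathLaw 0 := by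
  have h := W.le_tsum_returnProb.antisymm W.tsum_returnProb_le
  rw [← one_add_kappa, tsum_eq_zero_add' ENNReal.summable, ← lintegral_visits,
    show W.returnProb 0 = 1 by simp [returnProb], ENNReal.ofReal_one] at h
  exact (ENNReal.add_right_inj ENNReal.one_ne_top).1 h

/-! ### Subharmonic functions. -/

section Subharmonic

variable {W : ReflectingWalk} {v : ℕ → ℝ}

lemma p_mul_incr_one_ge (hv : v ≤ W.transitionOp v) :
    (W.q₁ 1 + W.q₂ 1) * (v 1 - v 0) ≤ W.p 1 * (v 2 - v 1) := by
  have h := hv 1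
  have hs : W.p 1 = 1 - W.q₁ 1 - W.q₂ 1 := by linarith [W.sum_eq_one 1 le_rfl]
  rw [W.transitionOp_of_pos _ le_rfl] at h
  norm_num at h
  rw [hs] at h ⊢
  linarith

lemma p_mul_incr_ge (hv : v ≤ W.transitionOp v) (k : ℕ) :
    W.q₁ (k + 2) * (v (k + 2) - v (k + 1)) +
      W.q₂ (k + 2) * ((v (k + 2) - v (k + 1)) + (v (k + 1) - v k)) ≤
      W.p (k + 2) * (v (k + 3) - v (k + 2)) := by
  have h := hv (k + 2)
  have hs : W.p (k + 2) = 1 - W.q₁ (k + 2) - W.q₂ (k + 2) := by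
    linarith [W.sum_eq_one (k + 2) (by omega)]
  rw [W.transitionOp_of_pos _ (by omega)] at h
  simp only [show k + 2 + 1 = k + 3 from rfl, show k + 2 - 1 = k + 1 from rfl,
    Nat.add_sub_cancel] at h
  rw [hs] at h ⊢
  linarith

/-- Reflection at `0` gives `v 0 ≤ v 1`; the increment inequalities have nonnegative coefficients
and propagate this. -/
lemma monotone_of_le_transitionOp (hv : v ≤ W.transitionOp v) : Monotone v := by
  refine monotone_nat_of_le_succ fun x => sub_nonneg.1 ?_
  induction x using Nat.twoStepInduction with
  | zero => simpa [transitionOp_zero] using hv 0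
  | one =>
    exact nonneg_of_mul_nonneg_right
      ((mul_nonneg (W.q_add_pos le_rfl).le
        (by simpa [transitionOp_zero] using hv 0)).trans (p_mul_incr_one_ge hv)) (W.p_pos 1 le_rfl)
  | more k h0 h1 =>
    refine nonneg_of_mul_nonneg_right (le_trans ?_ (p_mul_incr_ge hv k))
      (W.p_pos (k + 2) (by omega))
    exact add_nonneg (mul_nonneg (W.q₁_nonneg _ (by omega)) h1)
      (mul_nonneg (W.q₂_nonneg _ (by omega)) (add_nonneg h1 h0))

lemma incr_succ_pos (hv : v ≤ W.transitionOp v) {x : ℕ} (hx : v x < v (x + 1)) :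
    v (x + 1) < v (x + 2) := by
  have hmono := monotone_of_le_transitionOp hv
  refine sub_pos.1 (pos_of_mul_pos_right ?_ (W.p_pos (x + 1) (by omega)).le)
  have hpos := mul_pos (W.q_add_pos (x := x + 1) (by omega)) (sub_pos.2 hx)
  rcases x with _ | k
  · exact hpos.trans_le (p_mul_incr_one_ge hv)
  · refine lt_of_lt_of_le ?_ (p_mul_incr_ge hv k)
    have := mul_nonneg (W.q₂_nonneg (k + 2) (by omega))
      (sub_nonneg.2 (hmono (Nat.le_succ k)))
    simp only [Nat.succ_eq_add_one, Nat.add_assoc, Nat.reduceAdd] at this hpos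
    linarith

/-- The increments of a subharmonic function dominate a multiple of those of the scale function. -/
lemma exists_scaleIncr_le (hv : v ≤ W.transitionOp v) {i : ℕ} (hi : v i < v (i + 1)) :
    ∃ c > 0, ∀ k, c * W.scaleIncr (i + k) ≤ v (i + k + 1) - v (i + k) := by
  have h0 := W.scaleIncr_pos i
  have h1 := W.scaleIncr_pos (i + 1)
  have hi' := incr_succ_pos hv hi
  -- The recursion has order two, so `c` must work for two consecutive initial increments.
  refine ⟨min ((v (i + 1) - v i) / W.scaleIncr i) ((v (i + 2) - v (i + 1)) / W.scaleIncr (i + 1)),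
    lt_min (div_pos (sub_pos.2 hi) h0) (div_pos (sub_pos.2 hi') h1), fun k => ?_⟩
  induction k using Nat.twoStepInduction with
  | zero => exact (le_div_iff₀ h0).1 (min_le_left _ _)
  | one => exact (le_div_iff₀ h1).1 (min_le_right _ _)
  | more k ih0 ih1 =>
    set c := min ((v (i + 1) - v i) / W.scaleIncr i)
      ((v (i + 2) - v (i + 1)) / W.scaleIncr (i + 1))
    refine le_of_mul_le_mul_left (le_trans ?_ (p_mul_incr_ge hv (i + k)))
      (W.p_pos (i + k + 2) (by omega))
    have e1 := mul_le_mul_of_nonneg_left ih1 (W.q₁_nonneg (i + k + 2) (by omega))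
    have e2 := mul_le_mul_of_nonneg_left (add_le_add ih1 ih0) (W.q₂_nonneg (i + k + 2) (by omega))
    simp only [← Nat.add_assoc] at e1 e2 ⊢
    have := W.p_mul_scaleIncr (i + k)
    linear_combination c * this + e1 + e2

/-- If `κ = ∞`, bounded nonnegative subharmonic functions with a zero at `i` have mean zero after
one step from `i`. -/
lemma transitionOp_eq_zero_of_kappa_eq_top (hκ : W.kappa = ⊤) (hv : v ≤ W.transitionOp v)
    (hv0 : 0 ≤ v) (hv1 : v ≤ 1) {i : ℕ} (hi : v i = 0) : W.transitionOp v i = 0 := by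
  have hmono := monotone_of_le_transitionOp hv
  have hsucc : v (i + 1) = 0 := by
    by_contra hne
    have hlt : v i < v (i + 1) := by
      rw [hi]
      exact lt_of_le_of_ne (hv0 _) (Ne.symm hne)
    obtain ⟨c, hc, hle⟩ := exists_scaleIncr_le hv hlt
    have hsum : Summable fun k => c * W.scaleIncr (i + k) := by
      refine summable_of_sum_range_le (c := 1)
        -- The increments of `v` telescope to at most `1`.
        (fun k => mul_nonneg hc.le (W.scaleIncr_pos _).le) fun n => ?_
      refine (Finset.sum_le_sum fun k _ => hle k).trans ?_
      have := Finset.sum_range_sub (fun k => v (i + k)) n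
      simp only [← Nat.add_assoc] at this
      rw [this, Nat.add_zero, hi, sub_zero]
      exact hv1 _
    have hsum' : Summable W.scaleIncr := by
      rw [← summable_nat_add_iff i]
      simpa [add_comm] using (summable_mul_left_iff hc.ne').1 hsum
    have h := W.one_add_kappa
    rw [hκ, add_top, ← ENNReal.ofReal_tsum_of_nonneg (fun k => (W.scaleIncr_pos k).le) hsum'] at h
    exact ENNReal.ofReal_ne_top h.symm
  have hzero (x : ℕ) (hx : x ≤ i + 1) : v x = 0 :=
    le_antisymm (hsucc ▸ hmono hx) (hv0 x)
  rcases Nat.eq_zero_or_pos i with rfl | hpos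
  · rw [transitionOp_zero, hzero 1 le_rfl]
  · rw [W.transitionOp_of_pos _ hpos, hzero _ le_rfl, hzero (i - 1) (by omega),
      hzero (i - 2) (by omega)]
    simp

end Subharmonic

/-! ### Avoidance probabilities and recurrence. -/

/-- The probability, as a function of the starting site, of avoiding `i` at the times
`1, …, n`. -/
def avoidProb (W : ReflectingWalk) (i n : ℕ) : ℕ → ℝ :=
  (fun g => W.transitionOp (Set.indicator {i}ᶜ 1 * g))^[n] 1

lemma indicator_nonneg (i : ℕ) : (0 : ℕ → ℝ) ≤ Set.indicator {i}ᶜ 1 :=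
  fun _ => Set.indicator_nonneg (by simp) _

lemma indicator_le_one (i : ℕ) : (Set.indicator {i}ᶜ 1 : ℕ → ℝ) ≤ 1 :=
  Set.indicator_le_self' (by simp)

lemma avoidProb_nonneg (W : ReflectingWalk) (i n : ℕ) : 0 ≤ W.avoidProb i n := by
  induction n with
  | zero => exact zero_le_one
  | succ n ih =>
    rw [avoidProb, Function.iterate_succ_apply']
    exact W.transitionOp_nonneg (mul_nonneg (indicator_nonneg i) ih)

lemma avoidProb_antitone (W : ReflectingWalk) (i : ℕ) : Antitone (W.avoidProb i) := by
  refine Monotone.antitone_iterate_of_map_le (fun g h hgh => ?_) ?_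
  · exact W.transitionOp_mono (mul_le_mul_of_nonneg_left hgh (indicator_nonneg i))
  · rw [mul_one]
    exact (W.transitionOp_mono (indicator_le_one i)).trans (W.transitionOp_const 1).le

lemma tendsto_avoidProb_zero (W : ReflectingWalk) (hκ : W.kappa = ⊤) (i : ℕ) :
    Tendsto (fun n => W.avoidProb i n i) atTop (𝓝 0) := by
  set φ : ℕ → ℝ := Set.indicator {i}ᶜ 1 with hφ
  set a : ℕ → ℝ := fun x => ⨅ n, W.avoidProb i n x
  have hbdd (x : ℕ) : BddBelow (Set.range fun n => W.avoidProb i n x) :=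
    ⟨0, by rintro _ ⟨n, rfl⟩; exact W.avoidProb_nonneg i n x⟩
  have ha (x : ℕ) : Tendsto (fun n => W.avoidProb i n x) atTop (𝓝 (a x)) :=
    tendsto_atTop_ciInf (fun m n hmn => W.avoidProb_antitone i hmn x) (hbdd x)
  have ha0 : 0 ≤ a := fun x => le_ciInf fun n => W.avoidProb_nonneg i n x
  have ha1 : a ≤ 1 := fun x => ciInf_le (hbdd x) 0
  -- First-step equation for never meeting `i`, obtained as the limit of the iteration.
  have hfix : W.transitionOp (φ * a) = a := by
    ext x
    have h1 := W.tendsto_transitionOp (fun y => (ha y).const_mul (φ y)) x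
    refine tendsto_nhds_unique h1 (((tendsto_add_atTop_iff_nat 1).2 (ha x)).congr fun n => ?_)
    rw [avoidProb, Function.iterate_succ_apply']
    rfl
  have hle : φ * a ≤ a := fun x => mul_le_of_le_one_left (ha0 x) (indicator_le_one i x)
  -- `φ * a` is subharmonic because `φ * a ≤ a = P (φ * a)`.
  have h := transitionOp_eq_zero_of_kappa_eq_top (v := φ * a) hκ (hle.trans hfix.ge)
    (mul_nonneg (indicator_nonneg i) ha0) (hle.trans ha1) (i := i) (by simp [hφ])
  rw [hfix] at h
  simpa [h] using ha i

lemma pathLaw_avoid (W : ReflectingWalk) (i n : ℕ) :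
    W.pathLaw i {ω | ∀ m < n, ω (m + 1) ≠ i} = ENNReal.ofReal (W.avoidProb i n i) := by
  have h := W.lintegral_pathLaw_prod (indicator_nonneg i) i n (f := 1) zero_le_one
  rw [avoidProb, ← h]
  have hm : MeasurableSet {ω : ℕ → ℕ | ∀ m < n, ω (m + 1) ≠ i} := by
    simp only [Set.ofPred_forall]
    exact .iInter fun m => .iInter fun _ =>
      (measurableSet_singleton i).compl.preimage (measurable_pi_apply (m + 1))
  rw [← lintegral_indicator_one hm]
  refine lintegral_congr fun ω => ?_
  simp only [Pi.one_apply, ENNReal.ofReal_one, mul_one]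
  by_cases hω : ∀ m < n, ω (m + 1) ≠ i
  · rw [Set.indicator_of_mem (by exact hω)]
    exact (Finset.prod_eq_one fun m hm => by simp [hω m (Finset.mem_range.1 hm)]).symm
  · rw [Set.indicator_of_notMem (by exact hω)]
    push Not at hω
    obtain ⟨m, hmn, hm⟩ := hω
    exact (Finset.prod_eq_zero (Finset.mem_range.2 hmn) (by simp [hm])).symm

lemma hittingTime_lt_top_iff (i : ℕ) (ω : ℕ → ℕ) :
    hittingTime i ω < ⊤ ↔ ∃ n, ω (n + 1) = i := by
  simp only [hittingTime, iInf_lt_iff]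
  constructor
  · rintro ⟨n, ⟨hn, h⟩, -⟩
    exact ⟨n - 1, by rwa [Nat.sub_add_cancel hn]⟩
  · rintro ⟨n, h⟩
    exact ⟨n + 1, ⟨n.succ_pos, h⟩, ENat.natCast_lt_top _⟩

lemma isRecurrent_of_kappa_eq_top (W : ReflectingWalk) (hκ : W.kappa = ⊤) : W.IsRecurrent := by
  intro i
  have hm : MeasurableSet {ω : ℕ → ℕ | hittingTime i ω < ⊤} := by
    simp only [hittingTime_lt_top_iff, Set.ofPred_exists]
    exact .iUnion fun n => (measurableSet_singleton i).preimage (measurable_pi_apply (n + 1))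
  rw [← prob_compl_eq_zero_iff hm]
  have hlim := ENNReal.tendsto_ofReal (W.tendsto_avoidProb_zero hκ i)
  rw [ENNReal.ofReal_zero] at hlim
  refine le_antisymm (ge_of_tendsto hlim (Eventually.of_forall fun n => ?_)) zero_le
  rw [← pathLaw_avoid]
  refine measure_mono fun ω hω m _ h => hω ?_
  exact (hittingTime_lt_top_iff i ω).2 ⟨m, h⟩

end ReflectingWalk

end

theorem theorem1p1 (W : ReflectingWalk) :
    (W.kappa = ⊤ → W.IsRecurrent) ∧
      W.kappa = ∫⁻ ω, ReflectingWalk.visits 0 ω ∂(W.pathLaw 0) := by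
  exact ⟨W.isRecurrent_of_kappa_eq_top, W.kappa_eq_lintegral_visits⟩
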